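/- **Setting.** Let $\mathcal X$ be a finite set with $|\mathcal X|=N$ and let $\Delta_{\mathcal X}$ be the set of probability distributions on $\mathcal X$, written as vectors. For $q\in\Delta_{\mathcal X}$ and $B\subseteq\mathcal X$ put $q(B)=\sum_{x\in B}q_x$, and for $t\in[0,1]$ put $B_t=B_t(q)=\{x: q_x=t\}$. A distribution $q$ belongs to $\mathcal C(p,\alpha_1,\alpha_2)$ (is $(\alpha_1,\alpha_2)$-approximately calibrated with respect to $p$) if there is a set $T\subseteq[0,1]$ such that $(1-\alpha_1)p(B_t)\le q(B_t)\le(1+\alpha_1)p(B_t)$ for all $t\in[0,1]\setminus T$, $q(B_t)\ge(1-\alpha_1)p(B_t)$ for all $t\in T$, and $q\big(\bigcup_{t\in T}B_t\big)\le\alpha_2$. For a loss function $\ell:\Delta_{\mathcal X}\times\mathcal X\to\mathbb R$ write $\ell(q;p)=\sum_x p_x\,\ell(q,x)$. A function $f$ is $b(z)$-left-strongly concave if for every $z\ge 1$ and all $y,y'\in[1,z]$, $f(y)\le f(y')+f'(y')(y-y')-\frac{b(z)}2(y-y')^2$. **Theorem.** There is a universal constant $c_1>0$ with the following property. Let $\ell$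 be a local loss function with $\ell(q,x)=f(1/q_x)$ (whenever $q_x>0$), where $f$ is nonnegative, nondecreasing, concave and differentiable on $[1,\infty)$. Suppose that $f(z)\le c\sqrt z$ for all $z\ge1$ and some constant $c$; that $f'(z)\le D(z)/z$ for all $z\ge 1$ and some nondecreasing function $D$ on $[1,\infty)$; and that $f$ is $\frac{C(z)}{z^2}$-left-strongly concave, where $C$ is nonincreasing and nonnegative on $[1,\infty)$. Let $p\in\Delta_{\mathcal X}$ and $q\in\mathcal C(p,\alpha_1,\alpha_2)$, where $\alpha_2>0$, $\alpha_1,\alpha_2\le\frac{\|p-q\|_1^2}{12}$ and $C\!\left(\frac{2N}{\alpha_2}\right)>0$. Let $0<\delta\le1$, $$\beta=\frac{576\,N^8}{\delta\cdot\min\!\left(1,\left[C\!\left(\frac{2N}{\alpha_2}\right)\cdot\frac{\|p-q\|_1^2}{128\,c}\right]^2\right)},$$ and let $\hat p$ be the empirical distribution of $m$ independent samples from $p$, where $m\le N$ and $$m\ \ge\ \frac{c_1\, f(\beta)^2\,\ln\frac1\delta}{\left(C\!\left(\frac{N}{2\alpha_2}\right)\|p-q\|_1^2\right)^2}.$$ Then,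 with probability at least $1-\delta$, $$\ell(q;\hat p)-\ell(p;\hat p)\;>\;C\!\left(\frac{N}{2\alpha_2}\right)\cdot\frac{\|p-q\|_1^2}{384}\;-\;2\alpha_1 D\!\left(\frac{N}{2\alpha_2}\right)\;-\;3\alpha_2 f\!\left(\frac{N}{3\alpha_2}\right).$$ -/

import Mathlib

open Set MeasureTheory ProbabilityTheory

universe u v

namespace LossDist

/-- The `ℓ₁` distance between two vectors indexed by a finite domain. -/
def l1Dist {X : Type u} [Fintype X] (p q : X → ℝ) : ℝ := ∑ x, |p x - q x|

open Classical in
/-- The mass `q(B)` that a vector of probabilities `q` places on a set `B`. -/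
noncomputable def mass {X : Type u} [Fintype X] (q : X → ℝ) (B : Set X) : ℝ :=
  ∑ x, if x ∈ B then q x else 0

/-- The bucket `B_t(q) = {x : q_x = t}`. -/
def bucket {X : Type u} (q : X → ℝ) (t : ℝ) : Set X := {x | q x = t}

/-- `q` is `(α₁, α₂)`-approximately calibrated with respect to `p`: for some set `T ⊆ [0,1]` of
levels, `q(B_t) ∈ (1 ± α₁) p(B_t)` for levels outside `T`, `q(B_t) ≥ (1 - α₁) p(B_t)` for levels
in `T`, and the buckets with level in `T` have total `q`-mass at most `α₂`. -/
def ApproxCalibrated {X : Type u} [Fintype X] (p : X → ℝ) (α₁ α₂ : ℝ) (q : X → ℝ) : Prop :=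
  ∃ T : Set ℝ, T ⊆ Icc 0 1 ∧
    (∀ t ∈ Icc (0 : ℝ) 1 \ T,
      (1 - α₁) * mass p (bucket q t) ≤ mass q (bucket q t) ∧
      mass q (bucket q t) ≤ (1 + α₁) * mass p (bucket q t)) ∧
    (∀ t ∈ T, (1 - α₁) * mass p (bucket q t) ≤ mass q (bucket q t)) ∧
    mass q (⋃ t ∈ T, bucket q t) ≤ α₂

/-- The set `𝒞(p, α₁, α₂)` of all distributions that are `(α₁, α₂)`-approximately calibrated
with respect to `p`. -/
def approxCalibratedSet {X : Type u} [Fintype X] (p : X → ℝ) (α₁ α₂ : ℝ) : Set (X → ℝ) :=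
  {q | q ∈ stdSimplex ℝ X ∧ ApproxCalibrated p α₁ α₂ q}

/-- `ℓ` is the local loss `ℓ(q, x) = f(1 / q_x)`. Its value where `q_x = 0` (where `1 / q_x` is
infinite) is left arbitrary. -/
def IsInverseLoss {X : Type u} [Fintype X] (ℓ : (X → ℝ) → X → ℝ) (f : ℝ → ℝ) : Prop :=
  ∀ q ∈ stdSimplex ℝ X, ∀ x, 0 < q x → ℓ q x = f (1 / q x)

/-- The expected loss `ℓ(q; p) = E_{X ∼ p} ℓ(q, X)`. -/
def expectedLoss {X : Type u} [Fintype X] (ℓ : (X → ℝ) → X → ℝ) (q p : X → ℝ) : ℝ :=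
  ∑ x, p x * ℓ q x

open Classical in
/-- The empirical distribution of the sample `s₁, …, s_m`. -/
noncomputable def empirical {X : Type u} {m : ℕ} (s : Fin m → X) : X → ℝ :=
  fun x => ((Finset.univ.filter fun i => s i = x).card : ℝ) / m

/-- `f`, as a function on the set `s`, is `b`-strongly concave (first-order form). -/
def StronglyConcaveOn (f : ℝ → ℝ) (s : Set ℝ) (b : ℝ) : Prop :=
  ∀ z ∈ s, ∀ z' ∈ s, f z ≤ f z' + derivWithin f s z' * (z - z') - b / 2 * (z - z') ^ 2

/-- `f` is `b(z)`-left-strongly concave: for every `z`, its restriction to the part of the domain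
to the left of `z` is `b(z)`-strongly concave. The domain is `[1, ∞)`, which is where the
arguments `1 / q_x` of `f` lie; asking for this on `[1, z]` is weaker than on `[0, z]`. -/
def LeftStronglyConcave (f b : ℝ → ℝ) : Prop :=
  ∀ z, 1 ≤ z → StronglyConcaveOn f (Icc 1 z) (b z)

/-- `S₁, …, S_m` are independent samples from the distribution `p`. -/
def IsIIDSample {X : Type u} [MeasurableSpace X] {Ω : Type v} [MeasurableSpace Ω]
    (P : Measure Ω) {m : ℕ} (S : Fin m → Ω → X) (p : X → ℝ) : Prop :=
  (∀ i, Measurable (S i)) ∧ iIndepFun S P ∧ ∀ i x, P.real (S i ⁻¹' {x}) = p x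

end LossDist

/-!
The excess loss of `q` on a sample is a sum of independent terms, so the theorem amounts to a lower
bound on its mean, plus concentration.

For the mean, comparing `f` with its tangent at `1 / q x` bounds the loss below by a linear term
`w (q x) * (p x - q x)` plus, when `q x < p x`, a quadratic gain from strong concavity. The weight
`w` depends on `x` only through the level `q x`, so calibration makes the linear terms cancel up to
`α₁ D`, and by Cauchy–Schwarz the quadratic gains add up to a multiple of `‖p - q‖₁²`. This works
on calibrated levels at least `2 α₂ / N`. The other levels have `q`-mass less than `3 α₂`, and by
Jensen they lose at most `3 α₂ f (N / (3 α₂))`. If `‖p - q‖₁` is concentrated on those levels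
instead, Jensen has room for one more atom, whose share of the loss makes up for the missing gain.

For the concentration, terms with `p x < 2 N / β` may be huge, but conditionally on the likely event
that the sample avoids them all terms are at most `f β` in absolute value, and Hoeffding's
inequality applies to the conditional distribution.
-/

namespace LossDist

section Concave

variable {f b C D : ℝ → ℝ}

lemma le_add_derivWithin_mul_sub_of_concaveOn {s : Set ℝ} (hf : ConcaveOn ℝ s f) {y z : ℝ}
    (hd : DifferentiableWithinAt ℝ f s z) (hy : y ∈ s) (hz : z ∈ s) :
    f y ≤ f z + derivWithin f s z * (y - z) := by
  rcases lt_trichotomy y z with h | rfl | h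
  · have := hf.derivWithin_le_slope hy hz h hd
    rw [slope_def_field, le_div_iff₀ (sub_pos.2 h)] at this
    linarith
  · simp
  · have := hf.slope_le_derivWithin hz hy h hd
    rw [slope_def_field, div_le_iff₀ (sub_pos.2 h)] at this
    linarith

lemma derivWithin_Icc_right {a z : ℝ} (hd : DifferentiableWithinAt ℝ f (Ici a) z) (hz : a < z) :
    derivWithin f (Icc a z) z = derivWithin f (Ici a) z :=
  (hd.hasDerivWithinAt.mono Icc_subset_Ici_self).derivWithin
    (uniqueDiffOn_Icc hz z (right_mem_Icc.2 hz.le))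

lemma nonneg_of_derivWithin_le_div (hm : MonotoneOn f (Ici 1))
    (hD : ∀ z, 1 ≤ z → derivWithin f (Ici 1) z ≤ D z / z) {z : ℝ} (hz : 1 ≤ z) : 0 ≤ D z := by
  have hslope : 0 ≤ derivWithin f (Ici 1) z := hm.derivWithin_nonneg
  have := hslope.trans (hD z hz)
  rwa [le_div_iff₀ (by positivity), zero_mul] at this

lemma apply_two_mul_div_le (hC : AntitoneOn C (Ici 1)) {n a : ℝ} (ha : 0 < a)
    (hna : 1 ≤ n / (2 * a)) : C (2 * n / a) ≤ C (n / (2 * a)) := by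
  have hle : n / (2 * a) ≤ 2 * n / a := by
    have hn : 2 * n / a = 4 * (n / (2 * a)) := by field_simp; ring
    linarith
  exact hC hna (hna.trans hle) hle

lemma LeftStronglyConcave.le_at_right (hs : LeftStronglyConcave f b)
    (hd : DifferentiableOn ℝ f (Ici 1)) {y z : ℝ} (hy : 1 ≤ y) (hyz : y ≤ z) (hz : 1 < z) :
    f y ≤ f z + derivWithin f (Ici 1) z * (y - z) - b z / 2 * (y - z) ^ 2 := by
  have := hs z hz.le y ⟨hy, hyz⟩ z ⟨hz.le, le_rfl⟩
  rwa [derivWithin_Icc_right (hd z hz.le) hz] at this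

lemma LeftStronglyConcave.half_le_apply_two (hs : LeftStronglyConcave f b)
    (hd : DifferentiableOn ℝ f (Ici 1)) (hm : MonotoneOn f (Ici 1)) (hf1 : 0 ≤ f 1) :
    b 2 / 2 ≤ f 2 := by
  have hconcave := hs.le_at_right hd le_rfl one_le_two one_lt_two
  have hslope : 0 ≤ derivWithin f (Ici 1) 2 := hm.derivWithin_nonneg
  linarith

lemma LeftStronglyConcave.div_eight_le_apply_two (hs : LeftStronglyConcave f fun x => C x / x ^ 2)
    (hd : DifferentiableOn ℝ f (Ici 1)) (hm : MonotoneOn f (Ici 1)) (hf1 : 0 ≤ f 1)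
    (hC : AntitoneOn C (Ici 1)) {z : ℝ} (hz : 2 ≤ z) : C z / 8 ≤ f 2 := by
  have := hs.half_le_apply_two hd hm hf1
  have := hC (mem_Ici.2 one_le_two) (mem_Ici.2 (one_le_two.trans hz)) hz
  linarith

/-- The contribution `a (f (1 / b) - f (1 / a))` of an element of true probability `a` to the
expected excess loss of predicting `b` for it. -/
noncomputable def excessLoss (f : ℝ → ℝ) (a b : ℝ) : ℝ := a * (f (1 / b) - f (1 / a))

/-- The slope at `a = b` of the linear lower bound on `excessLoss f a b` which comes from the
tangent to the concave function `f` at `1 / b`. Since it depends on the prediction `b` only, these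
linear terms nearly cancel over a calibrated bucket. -/
noncomputable def tangentWeight (f : ℝ → ℝ) (b : ℝ) : ℝ := derivWithin f (Ici 1) (1 / b) / b

lemma tangentWeight_nonneg (hm : MonotoneOn f (Ici 1)) {b : ℝ} (hb : 0 ≤ b) :
    0 ≤ tangentWeight f b :=
  div_nonneg hm.derivWithin_nonneg hb

lemma tangentWeight_le (hD : ∀ z, 1 ≤ z → derivWithin f (Ici 1) z ≤ D z / z) {b : ℝ}
    (hb : 0 < b) (hb1 : b ≤ 1) : tangentWeight f b ≤ D (1 / b) := by
  rw [tangentWeight, div_le_iff₀ hb]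
  simpa using hD (1 / b) ((one_le_div hb).2 hb1)

lemma tangentWeight_mul_sub_le_excessLoss (hf : ConcaveOn ℝ (Ici 1) f)
    (hd : DifferentiableOn ℝ f (Ici 1)) (hm : MonotoneOn f (Ici 1)) {a b : ℝ}
    (ha : 0 ≤ a) (ha1 : a ≤ 1) (hb : 0 < b) (hb1 : b ≤ 1) :
    tangentWeight f b * (a - b) ≤ excessLoss f a b := by
  rw [tangentWeight, excessLoss]
  rcases ha.eq_or_lt with rfl | ha
  · have : 0 ≤ derivWithin f (Ici 1) (1 / b) := hm.derivWithin_nonneg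
    rw [zero_sub, zero_mul, mul_neg, div_mul_cancel₀ _ hb.ne']
    linarith
  have hz : 1 / b ∈ Ici (1 : ℝ) := (one_le_div hb).2 hb1
  have htangent := le_add_derivWithin_mul_sub_of_concaveOn hf (hd _ hz)
    (y := 1 / a) ((one_le_div ha).2 ha1) hz
  calc derivWithin f (Ici 1) (1 / b) / b * (a - b)
      = a * (-(derivWithin f (Ici 1) (1 / b) * (1 / a - 1 / b))) := by field_simp; ring
    _ ≤ a * (f (1 / b) - f (1 / a)) := mul_le_mul_of_nonneg_left (by linarith) ha.le

lemma tangentWeight_mul_sub_add_sq_le_excessLoss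
    (hs : LeftStronglyConcave f fun x => C x / x ^ 2) (hd : DifferentiableOn ℝ f (Ici 1))
    {a b : ℝ} (ha1 : a ≤ 1) (hb : 0 < b) (hba : b < a) :
    tangentWeight f b * (a - b) + C (1 / b) / 2 * ((a - b) ^ 2 / a) ≤ excessLoss f a b := by
  have ha := hb.trans hba
  have htangent := hs.le_at_right hd (y := 1 / a) (z := 1 / b)
    ((one_le_div ha).2 ha1) (one_div_le_one_div_of_le hb hba.le)
    ((one_lt_div hb).2 (hba.trans_le ha1))
  rw [tangentWeight, excessLoss]
  calc derivWithin f (Ici 1) (1 / b) / b * (a - b) + C (1 / b) / 2 * ((a - b) ^ 2 / a)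
      = a * (-(derivWithin f (Ici 1) (1 / b) * (1 / a - 1 / b)
          - C (1 / b) / (1 / b) ^ 2 / 2 * (1 / a - 1 / b) ^ 2)) := by field_simp; ring
    _ ≤ a * (f (1 / b) - f (1 / a)) := mul_le_mul_of_nonneg_left (by linarith) ha.le

lemma excessLoss_nonneg (hm : MonotoneOn f (Ici 1)) {a b : ℝ} (ha : 0 ≤ a) (ha1 : a ≤ 1)
    (hab : 0 < a → 0 < b) (hba : b ≤ a) : 0 ≤ excessLoss f a b := by
  rcases ha.eq_or_lt with rfl | ha
  · simp [excessLoss]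
  have hle := one_div_le_one_div_of_le (hab ha) hba
  have ha' := (one_le_div ha).2 ha1
  exact mul_nonneg ha.le (sub_nonneg.2 (hm ha' (ha'.trans hle) hle))

lemma mul_apply_one_div_le (hf : ConcaveOn ℝ (Ici 1) f) (hd : DifferentiableOn ℝ f (Ici 1))
    (hm : MonotoneOn f (Ici 1)) {a z : ℝ} (ha : 0 ≤ a) (ha1 : a ≤ 1) (hz : 1 ≤ z) :
    a * f (1 / a) ≤ a * f z + derivWithin f (Ici 1) z * (1 - a * z) := by
  rcases ha.eq_or_lt with rfl | ha
  · simpa using (hm.derivWithin_nonneg : 0 ≤ derivWithin f (Ici 1) z)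
  have htangent := le_add_derivWithin_mul_sub_of_concaveOn hf (hd z hz)
    (y := 1 / a) ((one_le_div ha).2 ha1) hz
  calc a * f (1 / a) ≤ a * (f z + derivWithin f (Ici 1) z * (1 / a - z)) := by gcongr
    _ = a * f z + derivWithin f (Ici 1) z * (1 - a * z) := by field_simp

/-- Jensen's inequality for the atoms `1 / p x` of mass `p x` and an extra atom `y`; an atom with
`p x = 0` adds nothing on the left and can only increase the mean. -/
lemma sum_mul_apply_one_div_add_le {X : Type*} (hf : ConcaveOn ℝ (Ici 1) f)
    (hd : DifferentiableOn ℝ f (Ici 1)) (hm : MonotoneOn f (Ici 1)) {p : X → ℝ} {A : Finset X}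
    (hp : ∀ x ∈ A, p x ∈ Icc 0 1) {v y n : ℝ} (hv : 0 < v) (huv : ∑ x ∈ A, p x ≤ v)
    (hy : 1 ≤ y) (hn : A.card + (v - ∑ x ∈ A, p x) * y ≤ n) :
    ∑ x ∈ A, p x * f (1 / p x) + (v - ∑ x ∈ A, p x) * f y ≤ v * f (n / v) := by
  have hu : ∑ x ∈ A, p x ≤ A.card := by
    simpa using Finset.sum_le_card_nsmul A p 1 fun x hx => (hp x hx).2
  have hz : 1 ≤ n / v := (one_le_div hv).2 (by nlinarith)
  set z := n / v
  set u := ∑ x ∈ A, p x with hu_def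
  have hatoms : ∑ x ∈ A, p x * f (1 / p x)
      ≤ u * f z + derivWithin f (Ici 1) z * (A.card - u * z) := by
    calc ∑ x ∈ A, p x * f (1 / p x)
        ≤ ∑ x ∈ A, (p x * f z + derivWithin f (Ici 1) z * (1 - p x * z)) :=
          Finset.sum_le_sum fun x hx => mul_apply_one_div_le hf hd hm (hp x hx).1 (hp x hx).2 hz
      _ = u * f z + derivWithin f (Ici 1) z * (A.card - u * z) := by
          simp only [Finset.sum_add_distrib, ← Finset.mul_sum, ← Finset.sum_mul,
            Finset.sum_sub_distrib, Finset.sum_const, nsmul_eq_mul, mul_one, hu_def]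
  have hextra := mul_le_mul_of_nonneg_left
    (le_add_derivWithin_mul_sub_of_concaveOn hf (hd z hz) (mem_Ici.2 hy) hz) (sub_nonneg.2 huv)
  have hslope : 0 ≤ derivWithin f (Ici 1) z := hm.derivWithin_nonneg
  have hvz : v * z = n := mul_div_cancel₀ n hv.ne'
  nlinarith [mul_le_mul_of_nonneg_left hn hslope]

end Concave

section Calibration

variable {X : Type u} [Fintype X] {p q : X → ℝ} {α₁ α₂ : ℝ} {T : Set ℝ}

lemma l1Dist_nonneg (p q : X → ℝ) : 0 ≤ l1Dist p q :=
  Finset.sum_nonneg fun _ _ => abs_nonneg _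

lemma l1Dist_le_two (hp : p ∈ stdSimplex ℝ X) (hq : q ∈ stdSimplex ℝ X) : l1Dist p q ≤ 2 := by
  calc l1Dist p q ≤ ∑ x, (p x + q x) := Finset.sum_le_sum fun x _ =>
        abs_sub_le_iff.2 ⟨by linarith [hq.1 x], by linarith [hp.1 x]⟩
    _ = 2 := by rw [Finset.sum_add_distrib, hp.2, hq.2]; norm_num

lemma sq_l1Dist_div_le (hp : p ∈ stdSimplex ℝ X) (hq : q ∈ stdSimplex ℝ X) :
    l1Dist p q ^ 2 / 12 ≤ 1 / 3 := by
  nlinarith [l1Dist_nonneg p q, l1Dist_le_two hp hq]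

lemma l1Dist_pos_of_sq_div_pos {r : ℝ} (h : 0 < l1Dist p q ^ 2 / r) : 0 < l1Dist p q :=
  (l1Dist_nonneg p q).lt_of_ne' fun hzero => by simp [hzero] at h

lemma sum_posPart_sub (hp : p ∈ stdSimplex ℝ X) (hq : q ∈ stdSimplex ℝ X) :
    ∑ x, (p x - q x)⁺ = l1Dist p q / 2 := by
  have hdiff : ∑ x, (p x - q x)⁺ - ∑ x, (p x - q x)⁻ = 0 := by
    simp only [← Finset.sum_sub_distrib, posPart_sub_negPart]
    rw [Finset.sum_sub_distrib, hp.2, hq.2, sub_self]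
  have habs : ∑ x, (p x - q x)⁺ + ∑ x, (p x - q x)⁻ = l1Dist p q := by
    simp only [← Finset.sum_add_distrib, posPart_add_negPart, l1Dist]
  linarith

lemma two_le_card_of_l1Dist_pos (hp : p ∈ stdSimplex ℝ X) (hq : q ∈ stdSimplex ℝ X)
    (hpq : 0 < l1Dist p q) : 2 ≤ Fintype.card X := by
  by_contra! hcard
  have : Subsingleton X := Fintype.card_le_one_iff_subsingleton.1 (by lia)
  have hone : ∀ r ∈ stdSimplex ℝ X, ∀ x, r x = 1 := fun r hr x => by
    rw [← hr.2, Fintype.sum_subsingleton _ x]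
  simp [l1Dist, hone p hp, hone q hq] at hpq

lemma two_le_card_div (hp : p ∈ stdSimplex ℝ X) (hq : q ∈ stdSimplex ℝ X) (hpq : 0 < l1Dist p q)
    {a : ℝ} (ha : 0 < a) (ha' : a ≤ 1 / 2) : 2 ≤ Fintype.card X / (2 * a) := by
  have : (2 : ℝ) ≤ Fintype.card X := by exact_mod_cast two_le_card_of_l1Dist_pos hp hq hpq
  rw [le_div_iff₀ (by positivity)]
  linarith

lemma sum_filter_lt_lt_card_mul [Nonempty X] (φ : X → ℝ) {τ : ℝ} (hτ : 0 < τ) :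
    ∑ x with φ x < τ, φ x < Fintype.card X * τ := by
  rw [Finset.sum_filter, ← nsmul_eq_mul, ← Finset.card_univ, ← Finset.sum_const]
  refine Finset.sum_lt_sum_of_nonempty Finset.univ_nonempty fun x _ => ?_
  split_ifs with hx
  exacts [hx, hτ]

lemma sum_le_card_univ_mul {A : Finset X} {φ : X → ℝ} {M : ℝ} (hM : 0 ≤ M)
    (h : ∀ x ∈ A, φ x ≤ M) : ∑ x ∈ A, φ x ≤ Fintype.card X * M := by
  calc ∑ x ∈ A, φ x ≤ A.card • M := Finset.sum_le_card_nsmul _ _ _ h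
    _ ≤ Fintype.card X * M := by
        rw [nsmul_eq_mul]
        gcongr
        exact Finset.card_le_univ A

lemma mass_eq_sum_filter (r : X → ℝ) (B : Set X) [DecidablePred (· ∈ B)] :
    mass r B = ∑ x with x ∈ B, r x := by
  rw [mass, Finset.sum_filter]
  exact Finset.sum_congr rfl fun x _ => by congr

lemma mass_nonneg {r : X → ℝ} (hr : ∀ x, 0 ≤ r x) (B : Set X) : 0 ≤ mass r B := by
  classical
  rw [mass_eq_sum_filter]
  exact Finset.sum_nonneg fun x _ => hr x

lemma le_mass_bucket {r : X → ℝ} (hr : ∀ x, 0 ≤ r x) (q : X → ℝ) (x : X) :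
    r x ≤ mass r (bucket q (q x)) := by
  classical
  rw [mass_eq_sum_filter]
  exact Finset.single_le_sum (fun y _ => hr y)
    (Finset.mem_filter.2 ⟨Finset.mem_univ x, rfl⟩)

lemma mass_bucket_le_card_mul {t : ℝ} (ht : 0 ≤ t) :
    mass q (bucket q t) ≤ Fintype.card X * t := by
  classical
  rw [mass_eq_sum_filter]
  exact sum_le_card_univ_mul ht fun x hx => (Finset.mem_filter.1 hx).2.le

lemma sum_filter_mem_mul_eq_sum_mul_mass (q r : X → ℝ) (w : ℝ → ℝ) (R : Set ℝ)
    [DecidablePred (· ∈ R)] :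
    ∑ x with q x ∈ R, w (q x) * r x
      = ∑ t ∈ Finset.univ.image q with t ∈ R, w t * mass r (bucket q t) := by
  classical
  rw [← Finset.sum_fiberwise_of_maps_to (g := q) (t := (Finset.univ.image q).filter (· ∈ R))
    fun x hx => by simpa using (Finset.mem_filter.1 hx).2]
  refine Finset.sum_congr rfl fun t ht => ?_
  rw [mass_eq_sum_filter, Finset.mul_sum, Finset.filter_filter]
  refine Finset.sum_congr (Finset.filter_congr fun x _ => ?_) fun x hx => ?_
  · exact ⟨And.right, fun hx => ⟨hx.symm ▸ (Finset.mem_filter.1 ht).2, hx⟩⟩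
  · rw [show q x = t from (Finset.mem_filter.1 hx).2]

lemma sum_filter_mem_mul_le_of_mass_bucket_le {r s : X → ℝ} {v w : ℝ → ℝ} {R : Set ℝ}
    [DecidablePred (· ∈ R)] (h : ∀ x, q x ∈ R →
      v (q x) * mass r (bucket q (q x)) ≤ w (q x) * mass s (bucket q (q x))) :
    ∑ x with q x ∈ R, v (q x) * r x ≤ ∑ x with q x ∈ R, w (q x) * s x := by
  rw [sum_filter_mem_mul_eq_sum_mul_mass, sum_filter_mem_mul_eq_sum_mul_mass]
  refine Finset.sum_le_sum fun t ht => ?_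
  obtain ⟨htq, htR⟩ := Finset.mem_filter.1 ht
  obtain ⟨x, -, rfl⟩ := Finset.mem_image.1 htq
  exact h x htR

/-- Calibration of `q` with respect to `p` with a named set `T` of exceptional levels. Only the
levels attained by `q` are constrained, as the other buckets are empty. -/
structure CalibratedOff (p : X → ℝ) (α₁ α₂ : ℝ) (q : X → ℝ) (T : Set ℝ) : Prop where
  le_mass (x : X) : (1 - α₁) * mass p (bucket q (q x)) ≤ mass q (bucket q (q x))
  mass_le (x : X) : q x ∉ T → mass q (bucket q (q x)) ≤ (1 + α₁) * mass p (bucket q (q x))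
  mass_preimage_le : mass q (q ⁻¹' T) ≤ α₂

lemma ApproxCalibrated.exists_calibratedOff (h : ApproxCalibrated p α₁ α₂ q)
    (hq : q ∈ stdSimplex ℝ X) : ∃ T, CalibratedOff p α₁ α₂ q T := by
  obtain ⟨T, -, hgood, hbad, hmass⟩ := h
  have hlevel (x : X) : q x ∈ Icc (0 : ℝ) 1 := mem_Icc_of_mem_stdSimplex hq x
  refine ⟨T, fun x => ?_, fun x hx => (hgood _ ⟨hlevel x, hx⟩).2, ?_⟩
  · by_cases hx : q x ∈ T
    exacts [hbad _ hx, (hgood _ ⟨hlevel x, hx⟩).1]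
  · rwa [← biUnion_preimage_singleton]

lemma CalibratedOff.sum_filter_le (h : CalibratedOff p α₁ α₂ q T)
    [DecidablePred (· ∈ T)] : ∑ x with q x ∈ T, q x ≤ α₂ := by
  classical
  have := h.mass_preimage_le
  rw [mass_eq_sum_filter] at this
  convert this using 3
  exact Iff.rfl

lemma CalibratedOff.nonneg (h : CalibratedOff p α₁ α₂ q T) (hp : p ∈ stdSimplex ℝ X)
    (hq : q ∈ stdSimplex ℝ X) (hα₂ : α₂ < 1) : 0 ≤ α₁ := by
  classical
  by_contra! hα₁
  have hzero : ∀ x, q x ∉ T → q x = 0 := fun x hx => by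
    have hle := h.le_mass x
    have hge := h.mass_le x hx
    have hmass : mass p (bucket q (q x)) = 0 :=
      (nonpos_of_mul_nonneg_right (by linarith) hα₁).antisymm (mass_nonneg hp.1 _)
    rw [hmass, mul_zero] at hge
    exact ((le_mass_bucket hq.1 q x).trans hge).antisymm (hq.1 x)
  have : ∑ x with q x ∈ T, q x = 1 := by
    rw [← hq.2]
    exact Finset.sum_filter_of_ne fun x _ hx => by_contra fun hT => hx (hzero x hT)
  linarith [h.sum_filter_le]

lemma CalibratedOff.mul_sum_filter_le (h : CalibratedOff p α₁ α₂ q T) (R : Set ℝ)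
    [DecidablePred (· ∈ R)] :
    (1 - α₁) * ∑ x with q x ∈ R, p x ≤ ∑ x with q x ∈ R, q x := by
  rw [Finset.mul_sum]
  simpa only [one_mul] using sum_filter_mem_mul_le_of_mass_bucket_le (r := p) (s := q)
    (v := fun _ => 1 - α₁) (w := fun _ => 1) fun x _ => (h.le_mass x).trans_eq (one_mul _).symm

lemma CalibratedOff.neg_mul_le_sum_filter (h : CalibratedOff p α₁ α₂ q T)
    (hp : p ∈ stdSimplex ℝ X) (hα₁ : 0 ≤ α₁) {R : Set ℝ} [DecidablePred (· ∈ R)]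
    (hRT : Disjoint R T) {w : ℝ → ℝ} {M : ℝ} (hM : 0 ≤ M)
    (hw : ∀ x, q x ∈ R → w (q x) ∈ Icc 0 M) :
    -(α₁ * M) ≤ ∑ x with q x ∈ R, w (q x) * (p x - q x) := by
  have hlevels : ∑ x with q x ∈ R, w (q x) * q x
      ≤ ∑ x with q x ∈ R, (w (q x) * (1 + α₁)) * p x :=
    sum_filter_mem_mul_le_of_mass_bucket_le (w := fun t => w t * (1 + α₁)) fun x hx => by
      rw [mul_assoc]
      exact mul_le_mul_of_nonneg_left (h.mass_le x (hRT.notMem_of_mem_left hx)) (hw x hx).1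
  have hmass : ∑ x with q x ∈ R, w (q x) * p x ≤ M := by
    calc ∑ x with q x ∈ R, w (q x) * p x ≤ ∑ x with q x ∈ R, M * p x :=
          Finset.sum_le_sum fun x hx => mul_le_mul_of_nonneg_right
            (hw x (Finset.mem_filter.1 hx).2).2 (hp.1 x)
      _ ≤ ∑ x, M * p x := Finset.sum_le_univ_sum_of_nonneg fun x => mul_nonneg hM (hp.1 x)
      _ = M := by rw [← Finset.mul_sum, hp.2, mul_one]
  simp only [mul_add, mul_one, add_mul, Finset.sum_add_distrib, mul_right_comm _ α₁,
    ← Finset.sum_mul] at hlevels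
  simp only [mul_sub, Finset.sum_sub_distrib]
  nlinarith

lemma CalibratedOff.mul_le_card_mul (h : CalibratedOff p α₁ α₂ q T) (hp : ∀ x, 0 ≤ p x)
    (hq : ∀ x, 0 ≤ q x) (hα₁ : α₁ ≤ 1) (x : X) : (1 - α₁) * p x ≤ Fintype.card X * q x :=
  calc (1 - α₁) * p x ≤ (1 - α₁) * mass p (bucket q (q x)) :=
        mul_le_mul_of_nonneg_left (le_mass_bucket hp q x) (sub_nonneg.2 hα₁)
    _ ≤ mass q (bucket q (q x)) := h.le_mass x
    _ ≤ Fintype.card X * q x := mass_bucket_le_card_mul (hq x)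

end Calibration

section ExpectedExcessLoss

variable {X : Type u} [Fintype X] {p q : X → ℝ} {f C D : ℝ → ℝ} {α₁ α₂ : ℝ} {T : Set ℝ}

lemma sq_sum_posPart_sub_le {X : Type*} {p q : X → ℝ} (hp : ∀ x, 0 ≤ p x) (hq : ∀ x, 0 ≤ q x)
    {A : Finset X} (hA : ∑ x ∈ A, p x ≤ 1) :
    (∑ x ∈ A, (p x - q x)⁺) ^ 2 ≤ ∑ x ∈ A, (p x - q x)⁺ ^ 2 / p x := by
  have hnonneg : ∀ x ∈ A, 0 ≤ (p x - q x)⁺ ^ 2 / p x := fun x _ =>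
    div_nonneg (sq_nonneg _) (hp x)
  have hcauchy := Finset.sum_sq_le_sum_mul_sum_of_sq_le_mul A hnonneg (fun x _ => hp x)
    (r := fun x => (p x - q x)⁺) fun x _ => by
      rcases (hp x).eq_or_lt with hx | hx
      · rw [← hx, zero_sub, posPart_eq_zero.2 (neg_nonpos.2 (hq x))]
        simp
      · exact (div_mul_cancel₀ _ hx.ne').ge
  exact hcauchy.trans (mul_le_of_le_one_right (Finset.sum_nonneg hnonneg) hA)

lemma mul_sq_sum_posPart_add_le_sum_excessLoss (hf : ConcaveOn ℝ (Ici 1) f)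
    (hd : DifferentiableOn ℝ f (Ici 1)) (hm : MonotoneOn f (Ici 1))
    (hs : LeftStronglyConcave f fun x => C x / x ^ 2) (hC : AntitoneOn C (Ici 1))
    (hp : p ∈ stdSimplex ℝ X) (hq : q ∈ stdSimplex ℝ X) {A : Finset X} {E : ℝ} (hE : 1 ≤ E)
    (hCE : 0 ≤ C E) (hA : ∀ x ∈ A, 1 / E ≤ q x) :
    C E / 2 * (∑ x ∈ A, (p x - q x)⁺) ^ 2 + ∑ x ∈ A, tangentWeight f (q x) * (p x - q x)
      ≤ ∑ x ∈ A, excessLoss f (p x) (q x) := by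
  have hgain : ∀ x ∈ A, C E / 2 * ((p x - q x)⁺ ^ 2 / p x)
      + tangentWeight f (q x) * (p x - q x) ≤ excessLoss f (p x) (q x) := by
    intro x hx
    have hq0 : 0 < q x := lt_of_lt_of_le (by positivity) (hA x hx)
    have hp1 : p x ≤ 1 := (mem_Icc_of_mem_stdSimplex hp x).2
    have hq1 : q x ≤ 1 := (mem_Icc_of_mem_stdSimplex hq x).2
    rcases le_or_gt (p x) (q x) with hpq | hpq
    · rw [posPart_eq_zero.2 (sub_nonpos.2 hpq)]
      simpa using tangentWeight_mul_sub_le_excessLoss hf hd hm (hp.1 x) hp1 hq0 hq1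
    · rw [posPart_eq_self.2 (sub_nonneg.2 hpq.le), add_comm]
      refine le_trans ?_ (tangentWeight_mul_sub_add_sq_le_excessLoss hs hd hp1 hq0 hpq)
      have := hp.1 x
      gcongr
      exact hC ((one_le_div hq0).2 hq1) hE (one_div_le (by positivity) hq0 |>.1 (hA x hx))
  have hA1 : ∑ x ∈ A, p x ≤ 1 := hp.2 ▸ Finset.sum_le_univ_sum_of_nonneg hp.1
  calc C E / 2 * (∑ x ∈ A, (p x - q x)⁺) ^ 2 + ∑ x ∈ A, tangentWeight f (q x) * (p x - q x)
      ≤ C E / 2 * (∑ x ∈ A, (p x - q x)⁺ ^ 2 / p x)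
        + ∑ x ∈ A, tangentWeight f (q x) * (p x - q x) := by
        gcongr
        exact sq_sum_posPart_sub_le hp.1 hq.1 hA1
    _ ≤ ∑ x ∈ A, excessLoss f (p x) (q x) := by
        rw [Finset.mul_sum, ← Finset.sum_add_distrib]
        exact Finset.sum_le_sum hgain

lemma CalibratedOff.sub_le_sum_excessLoss (h : CalibratedOff p α₁ α₂ q T)
    (hα₁ : 0 ≤ α₁) (hf : ConcaveOn ℝ (Ici 1) f)
    (hd : DifferentiableOn ℝ f (Ici 1)) (hm : MonotoneOn f (Ici 1)) (hDm : MonotoneOn D (Ici 1))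
    (hD : ∀ z, 1 ≤ z → derivWithin f (Ici 1) z ≤ D z / z)
    (hs : LeftStronglyConcave f fun x => C x / x ^ 2) (hC : AntitoneOn C (Ici 1))
    (hp : p ∈ stdSimplex ℝ X) (hq : q ∈ stdSimplex ℝ X) {E : ℝ} (hE : 1 ≤ E) (hCE : 0 ≤ C E)
    {R : Set ℝ} [DecidablePred (· ∈ R)] (hRT : Disjoint R T) (hRE : R ⊆ Ici (1 / E)) :
    C E / 2 * (∑ x with q x ∈ R, (p x - q x)⁺) ^ 2 - α₁ * D E
      ≤ ∑ x with q x ∈ R, excessLoss f (p x) (q x) := by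
  have hDE := nonneg_of_derivWithin_le_div hm hD hE
  have hweight : ∀ x, q x ∈ R → tangentWeight f (q x) ∈ Icc 0 (D E) := fun x hx => by
    have hqE : 1 / E ≤ q x := hRE hx
    have hq0 : 0 < q x := lt_of_lt_of_le (by positivity) hqE
    have hq1 : q x ≤ 1 := (mem_Icc_of_mem_stdSimplex hq x).2
    exact ⟨tangentWeight_nonneg hm hq0.le, (tangentWeight_le hD hq0 hq1).trans
      (hDm ((one_le_div hq0).2 hq1) hE ((one_div_le (by positivity) hq0).1 hqE))⟩
  have hlinear := h.neg_mul_le_sum_filter hp hα₁ hRT hDE hweight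
  have hgain := mul_sq_sum_posPart_add_le_sum_excessLoss hf hd hm hs hC hp hq hE hCE
    (A := Finset.univ.filter fun x => q x ∈ R) fun x hx => hRE (Finset.mem_filter.1 hx).2
  linarith

lemma mul_sub_le_sum_excessLoss (hf : ConcaveOn ℝ (Ici 1) f)
    (hd : DifferentiableOn ℝ f (Ici 1)) (hm : MonotoneOn f (Ici 1))
    (hp : p ∈ stdSimplex ℝ X) (hpq : ∀ x, 0 < p x → 0 < q x) (hq : ∀ x, 0 ≤ q x)
    {A : Finset X} {v y n : ℝ} (hv : 0 < v) (hqv : ∑ x ∈ A, q x ≤ v) (hy : 1 ≤ y)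
    (hyq : ∀ x ∈ A, y * q x ≤ 1) (hn : (A.filter fun x => p x < q x).card + v * y ≤ n) :
    v * (f y - f (n / v)) ≤ ∑ x ∈ A, excessLoss f (p x) (q x) := by
  set B := A.filter fun x => p x < q x
  have hBA : B ⊆ A := Finset.filter_subset _ _
  have hp01 (x : X) : p x ∈ Icc (0 : ℝ) 1 := mem_Icc_of_mem_stdSimplex hp x
  have hpB : ∑ x ∈ B, p x ≤ v := by
    calc ∑ x ∈ B, p x ≤ ∑ x ∈ B, q x :=
          Finset.sum_le_sum fun x hx => (Finset.mem_filter.1 hx).2.le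
      _ ≤ ∑ x ∈ A, q x := Finset.sum_le_sum_of_subset_of_nonneg hBA fun x _ _ => hq x
      _ ≤ v := hqv
  have hjensen := sum_mul_apply_one_div_add_le hf hd hm (fun x _ => hp01 x) hv hpB hy (n := n) (by
    nlinarith [Finset.sum_nonneg fun x (_ : x ∈ B) => hp.1 x])
  have hloss : (∑ x ∈ B, p x) * f y ≤ ∑ x ∈ B, p x * f (1 / q x) := by
    rw [Finset.sum_mul]
    refine Finset.sum_le_sum fun x hx => ?_
    rcases (hp.1 x).eq_or_lt with hx0 | hx0
    · simp [← hx0]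
    have hyx : y ≤ 1 / q x := (le_div_iff₀ (hpq x hx0)).2 (hyq x (hBA hx))
    exact mul_le_mul_of_nonneg_left (hm hy (hy.trans hyx) hyx) hx0.le
  calc v * (f y - f (n / v))
      ≤ ∑ x ∈ B, p x * f (1 / q x) - ∑ x ∈ B, p x * f (1 / p x) := by linarith
    _ = ∑ x ∈ B, excessLoss f (p x) (q x) := by
        simp only [excessLoss, mul_sub, Finset.sum_sub_distrib]
    _ ≤ ∑ x ∈ A, excessLoss f (p x) (q x) :=
        Finset.sum_le_sum_of_subset_of_nonneg hBA fun x hxA hxB =>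
          excessLoss_nonneg hm (hp01 x).1 (hp01 x).2 (hpq x)
            (not_lt.1 fun hx => hxB (Finset.mem_filter.2 ⟨hxA, hx⟩))

lemma neg_mul_le_sum_excessLoss (hf : ConcaveOn ℝ (Ici 1) f)
    (hd : DifferentiableOn ℝ f (Ici 1)) (hm : MonotoneOn f (Ici 1)) (hf1 : 0 ≤ f 1)
    (hp : p ∈ stdSimplex ℝ X) (hpq : ∀ x, 0 < p x → 0 < q x) (hq : q ∈ stdSimplex ℝ X)
    {A : Finset X} (hA : A ≠ Finset.univ) {v : ℝ} (hv : 0 < v) (hv1 : v ≤ 1)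
    (hqv : ∑ x ∈ A, q x ≤ v) :
    -(v * f (Fintype.card X / v)) ≤ ∑ x ∈ A, excessLoss f (p x) (q x) := by
  have hcard : ((A.filter fun x => p x < q x).card : ℝ) + 1 ≤ Fintype.card X := by
    exact_mod_cast (Finset.card_filter_le _ _).trans_lt
      (Finset.card_lt_card (Finset.ssubset_univ_iff.2 hA))
  have := mul_sub_le_sum_excessLoss hf hd hm hp hpq hq.1 hv hqv le_rfl
    (fun x _ => by simpa using (mem_Icc_of_mem_stdSimplex hq x).2) (n := Fintype.card X)
    (by linarith)
  nlinarith

lemma mul_apply_two_sub_le_sum_excessLoss (hf : ConcaveOn ℝ (Ici 1) f)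
    (hd : DifferentiableOn ℝ f (Ici 1)) (hm : MonotoneOn f (Ici 1))
    (hp : p ∈ stdSimplex ℝ X) (hpq : ∀ x, 0 < p x → 0 < q x) (hq : ∀ x, 0 ≤ q x)
    {A : Finset X} (hA : A ≠ Finset.univ) (hlt : ∃ x ∈ A, q x < p x)
    (hq2 : ∀ x ∈ A, q x ≤ 1 / 2) {v : ℝ} (hv : 0 < v) (hv1 : v ≤ 1) (hqv : ∑ x ∈ A, q x ≤ v) :
    v * (f 2 - f (Fintype.card X / v)) ≤ ∑ x ∈ A, excessLoss f (p x) (q x) := by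
  obtain ⟨x, hxA, hx⟩ := hlt
  have hfilter : (A.filter fun x => p x < q x).card < A.card :=
    Finset.card_lt_card (Finset.filter_ssubset.2 ⟨x, hxA, hx.not_gt⟩)
  have hcard : ((A.filter fun x => p x < q x).card : ℝ) + 2 ≤ Fintype.card X := by
    have hcardA : A.card < Fintype.card X := Finset.card_lt_card (Finset.ssubset_univ_iff.2 hA)
    exact_mod_cast show (A.filter fun x => p x < q x).card + 2 ≤ Fintype.card X by lia
  exact mul_sub_le_sum_excessLoss hf hd hm hp hpq hq hv hqv one_le_two
    (fun x hx => by linarith [hq2 x hx]) (by linarith)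

lemma CalibratedOff.sum_filter_union_Iio_lt [Nonempty X] (h : CalibratedOff p α₁ α₂ q T)
    (hq : ∀ x, 0 ≤ q x) {τ : ℝ} (hτ : 0 < τ) [DecidablePred (· ∈ T ∪ Iio τ)] :
    ∑ x with q x ∈ T ∪ Iio τ, q x < α₂ + Fintype.card X * τ := by
  classical
  calc ∑ x with q x ∈ T ∪ Iio τ, q x
      ≤ ∑ x with q x ∈ T, q x + ∑ x with q x < τ, q x := by
        rw [← Finset.sum_union_inter, Finset.filter_congr fun x _ => mem_union (q x) T (Iio τ),
          Finset.filter_or]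
        exact le_add_of_nonneg_right (Finset.sum_nonneg fun x _ => hq x)
    _ < α₂ + Fintype.card X * τ :=
        add_lt_add_of_le_of_lt h.sum_filter_le (sum_filter_lt_lt_card_mul q hτ)

lemma CalibratedOff.pos_of_pos (h : CalibratedOff p α₁ α₂ q T) (hp : ∀ x, 0 ≤ p x)
    (hq : ∀ x, 0 ≤ q x) (hα₁ : α₁ < 1) {x : X} (hx : 0 < p x) : 0 < q x :=
  pos_of_mul_pos_right ((mul_pos (sub_pos.2 hα₁) hx).trans_le (h.mul_le_card_mul hp hq hα₁.le x))
    (Nat.cast_nonneg _)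

lemma CalibratedOff.apply_le_of_mem_union_Iio (h : CalibratedOff p α₁ α₂ q T)
    (hq : ∀ x, 0 ≤ q x) {τ : ℝ} {x : X} (hx : q x ∈ T ∪ Iio τ) : q x ≤ max α₂ τ := by
  classical
  rcases hx with hxT | hxτ
  · exact le_max_of_le_left ((Finset.single_le_sum (fun y _ => hq y) (by simpa using hxT)).trans
      h.sum_filter_le)
  · exact le_max_of_le_right (mem_Iio.1 hxτ).le

lemma CalibratedOff.mul_sq_sub_le_sum_excessLoss_of_le (h : CalibratedOff p α₁ α₂ q T)
    (hα₁ : α₁ ≤ 1 / 3) (hα₂ : 0 < α₂) (hα₂' : α₂ ≤ 1 / 3)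
    (hf1 : 0 ≤ f 1) (hf : ConcaveOn ℝ (Ici 1) f)
    (hd : DifferentiableOn ℝ f (Ici 1)) (hm : MonotoneOn f (Ici 1))
    (hs : LeftStronglyConcave f fun x => C x / x ^ 2) (hC : AntitoneOn C (Ici 1))
    (hp : p ∈ stdSimplex ℝ X) (hq : q ∈ stdSimplex ℝ X)
    (hCE : 0 ≤ C (Fintype.card X / (2 * α₂))) (hpq : 0 < l1Dist p q)
    {R : Set ℝ} [DecidablePred (· ∈ R)] (hR : ∀ x, q x ∈ R → q x ≤ 1 / 2)
    (hqR : ∑ x with q x ∈ R, q x < 3 * α₂)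
    (hpqR : l1Dist p q * (2 / 5) ≤ ∑ x with q x ∈ R, (p x - q x)⁺) :
    C (Fintype.card X / (2 * α₂)) * (l1Dist p q ^ 2 / 200)
        - 3 * α₂ * f (Fintype.card X / (3 * α₂))
      ≤ ∑ x with q x ∈ R, excessLoss f (p x) (q x) := by
  set S := Finset.univ.filter fun x => q x ∈ R
  set E := Fintype.card X / (2 * α₂)
  have hS : S ≠ Finset.univ := fun hS => by
    rw [hS, hq.2] at hqR
    linarith
  have hlt : ∃ x ∈ S, q x < p x := by
    by_contra! hle
    have : ∑ x ∈ S, (p x - q x)⁺ = 0 :=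
      Finset.sum_eq_zero fun x hx => posPart_eq_zero.2 (sub_nonpos.2 (hle x hx))
    linarith
  have hloss := mul_apply_two_sub_le_sum_excessLoss hf hd hm hp
    (fun x => h.pos_of_pos hp.1 hq.1 (by linarith)) hq.1 hS hlt
    (fun x hx => hR x (Finset.mem_filter.1 hx).2) (v := 3 * α₂) (by linarith) (by linarith) hqR.le
  have hE : 2 ≤ E := two_le_card_div hp hq hpq hα₂ (by linarith)
  have hf2 : C E / 8 ≤ f 2 := hs.div_eight_le_apply_two hd hm hf1 hC hE
  have hdist : l1Dist p q * (2 / 5) ≤ 9 / 2 * α₂ := by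
    have hpS := h.mul_sum_filter_le R
    have hpos : ∑ x ∈ S, (p x - q x)⁺ ≤ ∑ x ∈ S, p x := Finset.sum_le_sum fun x _ =>
      sup_le (sub_le_self _ (hq.1 x)) (hp.1 x)
    nlinarith [Finset.sum_nonneg fun x (_ : x ∈ S) => hp.1 x]
  have hsq : l1Dist p q ^ 2 / 200 ≤ 3 * α₂ / 8 := by nlinarith [l1Dist_le_two hp hq]
  calc C E * (l1Dist p q ^ 2 / 200) - 3 * α₂ * f (Fintype.card X / (3 * α₂))
      ≤ 3 * α₂ * (f 2 - f (Fintype.card X / (3 * α₂))) := by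
        nlinarith [mul_le_mul_of_nonneg_left hsq hCE]
    _ ≤ ∑ x ∈ S, excessLoss f (p x) (q x) := hloss

lemma CalibratedOff.le_sum_excessLoss (h : CalibratedOff p α₁ α₂ q T)
    (hα₁ : α₁ ≤ 1 / 3) (hα₂ : 0 < α₂) (hα₂' : α₂ ≤ 1 / 3)
    (hf1 : 0 ≤ f 1) (hf : ConcaveOn ℝ (Ici 1) f)
    (hd : DifferentiableOn ℝ f (Ici 1)) (hm : MonotoneOn f (Ici 1)) (hDm : MonotoneOn D (Ici 1))
    (hD : ∀ z, 1 ≤ z → derivWithin f (Ici 1) z ≤ D z / z)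
    (hs : LeftStronglyConcave f fun x => C x / x ^ 2) (hC : AntitoneOn C (Ici 1))
    (hp : p ∈ stdSimplex ℝ X) (hq : q ∈ stdSimplex ℝ X)
    (hCE : 0 ≤ C (Fintype.card X / (2 * α₂))) (hpq : 0 < l1Dist p q) :
    C (Fintype.card X / (2 * α₂)) * (l1Dist p q ^ 2 / 200) - α₁ * D (Fintype.card X / (2 * α₂))
        - 3 * α₂ * f (Fintype.card X / (3 * α₂))
      ≤ ∑ x, excessLoss f (p x) (q x) := by
  classical
  have : Nonempty X :=
    Fintype.card_pos_iff.1 (zero_lt_two.trans_le (two_le_card_of_l1Dist_pos hp hq hpq))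
  set E := Fintype.card X / (2 * α₂) with hE_def
  have hE : 2 ≤ E := two_le_card_div hp hq hpq hα₂ (by linarith)
  have hE1 : 1 ≤ E := one_le_two.trans hE
  have hcardE : Fintype.card X * (1 / E) = 2 * α₂ := by
    rw [hE_def]
    field_simp
  set R : Set ℝ := T ∪ Iio (1 / E)
  have hqR : ∑ x with q x ∈ R, q x < 3 * α₂ :=
    (h.sum_filter_union_Iio_lt hq.1 (by positivity)).trans_eq (by rw [hcardE]; ring)
  have hgood := h.sub_le_sum_excessLoss (h.nonneg hp hq (by linarith)) hf hd hm hDm hD hs hC hp hq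
    hE1 hCE (R := Rᶜ) (disjoint_compl_left.mono_right subset_union_left)
    fun t ht => mem_Ici.2 (not_lt.1 fun hlt => ht (Or.inr hlt))
  simp only [mem_compl_iff] at hgood
  have hposPart := sum_posPart_sub hp hq
  rw [← Finset.sum_filter_add_sum_filter_not _ fun x => q x ∈ R] at hposPart ⊢
  rcases le_or_gt (l1Dist p q / 10) (∑ x with q x ∉ R, (p x - q x)⁺) with hcase | hcase
  · have hbad := neg_mul_le_sum_excessLoss hf hd hm hf1 hp
      (fun x => h.pos_of_pos hp.1 hq.1 (by linarith)) hq (A := Finset.univ.filter fun x => q x ∈ R)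
      (fun hS => by rw [hS, hq.2] at hqR; linarith) (v := 3 * α₂) (by linarith) (by linarith) hqR.le
    have hsq : (l1Dist p q / 10) ^ 2 ≤ (∑ x with q x ∉ R, (p x - q x)⁺) ^ 2 :=
      pow_le_pow_left₀ (by positivity) hcase 2
    have := mul_le_mul_of_nonneg_left hsq hCE
    linarith
  · have hbad := h.mul_sq_sub_le_sum_excessLoss_of_le hα₁ hα₂ hα₂' hf1 hf hd hm hs hC hp hq hCE hpq
      (fun x hx => (h.apply_le_of_mem_union_Iio hq.1 hx).trans (max_le (by linarith)
        (one_div_le_one_div_of_le two_pos hE))) hqR (by linarith)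
    have := mul_nonneg hCE (sq_nonneg (∑ x with q x ∉ R, (p x - q x)⁺))
    linarith

end ExpectedExcessLoss

section Sampling

variable {X : Type u} [MeasurableSpace X]
  {Ω : Type v} [MeasurableSpace Ω] {P : Measure Ω} {m : ℕ} {S : Fin m → Ω → X} {p : X → ℝ}

lemma expectedLoss_empirical {X : Type u} [Fintype X] (ℓ : (X → ℝ) → X → ℝ) (q : X → ℝ)
    (s : Fin m → X) : expectedLoss ℓ q (empirical s) = (∑ i, ℓ q (s i)) / m := by
  classical
  simp only [expectedLoss, empirical, div_mul_eq_mul_div]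
  rw [← Finset.sum_div, ← Finset.sum_fiberwise Finset.univ s fun i => ℓ q (s i)]
  congr 1
  refine Finset.sum_congr rfl fun x _ => ?_
  rw [Finset.sum_congr rfl fun i hi => by rw [(Finset.mem_filter.1 hi).2],
    Finset.sum_const, nsmul_eq_mul]

lemma IsIIDSample.ae_ne_zero [Finite X] (hS : IsIIDSample P S p) (i : Fin m) :
    ∀ᵐ ω ∂P, p (S i ω) ≠ 0 := by
  have := hS.2.1.isProbabilityMeasure
  have hnull : P (⋃ x ∈ {x | p x = 0}, S i ⁻¹' {x}) = 0 :=
    (measure_biUnion_null_iff (Set.toFinite _).countable).2 fun x hx =>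
      (measureReal_eq_zero_iff).1 ((hS.2.2 i x).trans hx)
  refine measure_mono_null (fun ω hω => ?_) hnull
  simpa using hω

variable [MeasurableSingletonClass X]

lemma IsIIDSample.measureReal_preimage (hS : IsIIDSample P S p) (G : Finset X) (i : Fin m) :
    P.real (S i ⁻¹' G) = ∑ x ∈ G, p x := by
  have := hS.2.1.isProbabilityMeasure
  rw [← map_measureReal_apply (hS.1 i) G.measurableSet,
    ← sum_measureReal_singleton]
  refine Finset.sum_congr rfl fun x _ => ?_
  rw [map_measureReal_apply (hS.1 i) (measurableSet_singleton x), hS.2.2]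

lemma IsIIDSample.measureReal_iInter_preimage (hS : IsIIDSample P S p) (G : Finset X) :
    P.real (⋂ i, S i ⁻¹' G) = (∑ x ∈ G, p x) ^ m := by
  have hprod := hS.2.1.meas_iInter fun i => ⟨(G : Set X), G.measurableSet, rfl⟩
  rw [measureReal_def, hprod, ENNReal.toReal_prod]
  simp only [← measureReal_def, hS.measureReal_preimage G, Finset.prod_const, Finset.card_univ,
    Fintype.card_fin]

lemma IsIIDSample.integral_comp [Fintype X] (hS : IsIIDSample P S p) (φ : X → ℝ) (i : Fin m) :
    ∫ ω, φ (S i ω) ∂P = ∑ x, p x * φ x := by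
  have := hS.2.1.isProbabilityMeasure
  have := Measure.isProbabilityMeasure_map (μ := P) (hS.1 i).aemeasurable
  rw [← integral_map (f := φ) (hS.1 i).aemeasurable (measurable_of_finite φ).aestronglyMeasurable,
    integral_fintype .of_finite]
  refine Finset.sum_congr rfl fun x _ => ?_
  rw [map_measureReal_apply (hS.1 i) (measurableSet_singleton x), hS.2.2, smul_eq_mul]

lemma IsIIDSample.cond (hS : IsIIDSample P S p) {G : Finset X} (hG : ∑ x ∈ G, p x ≠ 0) :
    IsIIDSample P[|⋂ i, S i ⁻¹' G] S fun x => (G : Set X).indicator p x / ∑ y ∈ G, p y := by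
  have := hS.2.1.isProbabilityMeasure
  have hpair : iIndepFun (fun i ω => (S i ω, S i ω)) P :=
    hS.2.1.comp (fun _ x => (x, x)) fun _ => measurable_id.prodMk measurable_id
  have hne : ∀ i, P (S i ⁻¹' G) ≠ 0 := fun i h =>
    hG ((hS.measureReal_preimage G i).symm.trans (by rw [measureReal_def, h, ENNReal.toReal_zero]))
  refine ⟨hS.1, iIndepFun.cond hS.1 hpair hne fun _ => G.measurableSet, fun i x => ?_⟩
  have hi := cond_iInter (s := {i}) (f := fun j => S j ⁻¹' {x}) hS.1 hpair
    (fun j _ => ⟨{x}, measurableSet_singleton x, rfl⟩) (fun j _ => hne j) fun _ => G.measurableSet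
  simp only [Finset.mem_singleton, iInter_iInter_eq_left, Finset.prod_singleton] at hi
  rw [measureReal_def, hi, cond_apply (hS.1 i G.measurableSet), ENNReal.toReal_mul,
    ENNReal.toReal_inv, ← measureReal_def, ← measureReal_def, hS.measureReal_preimage,
    ← Set.preimage_inter]
  refine Eq.trans (congrArg _ ?_) (div_eq_inv_mul _ _).symm
  by_cases hx : x ∈ G
  · rw [Set.inter_eq_self_of_subset_right (by simpa using hx), hS.2.2,
      Set.indicator_of_mem (by simpa using hx)]
  · rw [Set.inter_singleton_eq_empty.2 (by simpa using hx), Set.preimage_empty,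
      measureReal_empty, Set.indicator_of_notMem (by simpa using hx)]

lemma IsIIDSample.measureReal_sum_le [Fintype X] (hS : IsIIDSample P S p) {Y : X → ℝ}
    {F t γ : ℝ} (hF : 0 ≤ F) (hY : ∀ x, p x ≠ 0 → |Y x| ≤ F) (hγ : 0 ≤ γ)
    (ht : t + γ ≤ ∑ x, p x * Y x) :
    P.real {ω | ∑ i, Y (S i ω) ≤ m * t} ≤ Real.exp (-(m * (γ ^ 2 / (2 * F ^ 2)))) := by
  have := hS.2.1.isProbabilityMeasure
  set μ := ∑ x, p x * Y x
  have hmean (i : Fin m) : P[fun ω => -Y (S i ω)] = -μ := by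
    rw [hS.integral_comp fun x => -Y x]
    simp only [mul_neg, Finset.sum_neg_distrib, μ]
  have hsubG (i : Fin m) :
      HasSubgaussianMGF (fun ω => -Y (S i ω) - -μ) ((‖F - -F‖₊ / 2) ^ 2) P := by
    rw [← hmean i]
    exact hasSubgaussianMGF_of_mem_Icc
      ((measurable_of_finite fun x => -Y x).comp (hS.1 i)).aemeasurable
      ((hS.ae_ne_zero i).mono fun ω hω => abs_le.1 ((abs_neg _).trans_le (hY _ hω)))
  have hindep : iIndepFun (fun i ω => -Y (S i ω) - -μ) P :=
    hS.2.1.comp (fun _ x => -Y x - -μ) fun _ => measurable_of_finite _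
  have hwidth : ((‖F - -F‖₊ / 2 : NNReal) : ℝ) = F := by
    simp [abs_of_nonneg (add_nonneg hF hF)]
  have hoeffding := HasSubgaussianMGF.measure_sum_ge_le_of_iIndepFun hindep (s := Finset.univ)
    (fun i _ => hsubG i) (ε := m * γ) (by positivity)
  simp only [Finset.sum_sub_distrib, Finset.sum_neg_distrib, Finset.sum_const, Finset.card_univ,
    Fintype.card_fin, nsmul_eq_mul, NNReal.coe_mul, NNReal.coe_natCast, NNReal.coe_pow,
    hwidth] at hoeffding
  refine (measureReal_mono fun ω (hω : ∑ i, Y (S i ω) ≤ m * t) => ?_).trans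
    (hoeffding.trans_eq ?_)
  · rw [mem_ofPred_eq]
    nlinarith [mul_le_mul_of_nonneg_left ht (Nat.cast_nonneg (α := ℝ) m)]
  · rcases m.eq_zero_or_pos with rfl | hm
    · simp
    · have : (0 : ℝ) < m := by exact_mod_cast hm
      congr 1
      field_simp

lemma IsIIDSample.pow_mul_le_measureReal_lt_sum [Finite X] (hS : IsIIDSample P S p)
    {G : Finset X} (hG : 0 < ∑ x ∈ G, p x) {Y : X → ℝ} {F t γ : ℝ} (hF : 0 ≤ F)
    (hY : ∀ x ∈ G, |Y x| ≤ F) (hγ : 0 ≤ γ)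
    (ht : (∑ x ∈ G, p x) * (t + γ) ≤ ∑ x ∈ G, p x * Y x) :
    (∑ x ∈ G, p x) ^ m * (1 - Real.exp (-(m * (γ ^ 2 / (2 * F ^ 2)))))
      ≤ P.real {ω | m * t < ∑ i, Y (S i ω)} := by
  classical
  cases nonempty_fintype X
  have := hS.2.1.isProbabilityMeasure
  set g := ∑ x ∈ G, p x
  set A := ⋂ i, S i ⁻¹' (G : Set X)
  have hA : P.real A = g ^ m := hS.measureReal_iInter_preimage G
  have hA0 : P A ≠ 0 := fun h => (pow_pos hG m).ne' (by rw [← hA, measureReal_def, h]; rfl)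
  have := cond_isProbabilityMeasure hA0
  have hcond := (hS.cond hG.ne').measureReal_sum_le hF (Y := Y) (t := t)
    (fun x hx => hY x (by_contra fun h => hx (by simp [h]))) hγ (by
      rw [Finset.sum_congr rfl fun x _ => div_mul_eq_mul_div _ _ _, ← Finset.sum_div,
        le_div_iff₀ hG, mul_comm]
      simpa [Set.indicator_apply, ite_mul] using ht)
  have hcompl : 1 ≤ P[|A].real {ω | m * t < ∑ i, Y (S i ω)}
      + P[|A].real {ω | ∑ i, Y (S i ω) ≤ m * t} := by
    rw [← probReal_univ (μ := P[|A])]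
    refine (measureReal_mono fun ω _ => ?_).trans (measureReal_union_le _ _)
    exact lt_or_ge (m * t) (∑ i, Y (S i ω))
  have hinter : P[|A].real {ω | m * t < ∑ i, Y (S i ω)} * g ^ m
      ≤ P.real {ω | m * t < ∑ i, Y (S i ω)} := by
    rw [← hA, measureReal_def, measureReal_def, ← ENNReal.toReal_mul,
      cond_mul_eq_inter (.iInter fun i => hS.1 i G.measurableSet)]
    exact measureReal_mono inter_subset_right
  rw [mul_comm]
  exact (mul_le_mul_of_nonneg_right (by linarith) (pow_pos hG m).le).trans hinter

lemma IsIIDSample.one_sub_le_measureReal_lt_sum [Finite X] (hS : IsIIDSample P S p)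
    {G : Finset X} {Y : X → ℝ} {F t γ δ : ℝ} (hF : 0 < F) (hY : ∀ x ∈ G, |Y x| ≤ F) (hγ : 0 < γ)
    (ht : (∑ x ∈ G, p x) * (t + γ) ≤ ∑ x ∈ G, p x * Y x) (hδ : 0 < δ)
    (hG : m * (1 - ∑ x ∈ G, p x) ≤ δ / 4)
    (hm : 4 * F ^ 2 * Real.log (1 / δ) / γ ^ 2 ≤ m) :
    1 - δ ≤ P.real {ω | m * t < ∑ i, Y (S i ω)} := by
  rcases le_or_gt 1 δ with hδ1 | hδ1
  · exact (sub_nonpos.2 hδ1).trans measureReal_nonneg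
  have hm0 : (0 : ℝ) < m := by
    have := Real.log_pos (one_lt_one_div hδ hδ1)
    exact lt_of_lt_of_le (by positivity) hm
  have hm1 : (1 : ℝ) ≤ m := by exact_mod_cast hm0
  have hg : 0 < ∑ x ∈ G, p x := by
    by_contra! h
    nlinarith
  have hexp : Real.exp (-(m * (γ ^ 2 / (2 * F ^ 2)))) ≤ δ ^ 2 := by
    rw [div_le_iff₀ (by positivity), one_div, Real.log_inv] at hm
    rw [← Real.exp_log hδ, ← Real.exp_nat_mul, Real.exp_le_exp, neg_le, ← mul_div_assoc,
      le_div_iff₀ (by positivity)]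
    push_cast
    linarith
  have hbernoulli : 1 - δ / 4 ≤ (∑ x ∈ G, p x) ^ m := by
    linarith [one_add_mul_sub_le_pow (a := ∑ x ∈ G, p x) (by linarith) m]
  calc 1 - δ ≤ (1 - δ / 4) * (1 - δ ^ 2) := by
        nlinarith [mul_nonneg hδ.le (sub_nonneg.2 hδ1.le), sq_nonneg δ]
    _ ≤ (∑ x ∈ G, p x) ^ m * (1 - Real.exp (-(m * (γ ^ 2 / (2 * F ^ 2))))) := by
        gcongr
        exact sub_nonneg.2 (pow_le_one₀ hδ.le hδ1.le)
    _ ≤ _ := hS.pow_mul_le_measureReal_lt_sum hg hF.le hY hγ.le ht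

end Sampling

section Truncation

variable {f : ℝ → ℝ} {c β K : ℝ}

lemma nonneg_of_forall_le_mul_sqrt (hf1 : 0 ≤ f 1) (hfc : ∀ z, 1 ≤ z → f z ≤ c * √z) : 0 ≤ c := by
  simpa using hf1.trans (hfc 1 le_rfl)

lemma apply_one_div_mem_Icc (hf1 : 0 ≤ f 1) (hm : MonotoneOn f (Ici 1)) {a : ℝ} (ha : 0 < a)
    (ha1 : a ≤ 1) (haβ : 1 ≤ β * a) : f (1 / a) ∈ Icc 0 (f β) := by
  have hz : 1 ≤ 1 / a := (one_le_div ha).2 ha1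
  have hzβ : 1 / a ≤ β := (div_le_iff₀ ha).2 haβ
  exact ⟨hf1.trans (hm (mem_Ici.2 le_rfl) hz hz), hm hz (hz.trans hzβ) hzβ⟩

lemma excessLoss_le_mul_div_sqrt (hf1 : 0 ≤ f 1) (hm : MonotoneOn f (Ici 1))
    (hfc : ∀ z, 1 ≤ z → f z ≤ c * √z) (hβ : 0 < β) (hK : 0 < K) {a b : ℝ} (ha : 0 ≤ a)
    (ha1 : a ≤ 1) (hb1 : b ≤ 1) (hab : a ≤ K * b) (haβ : a ≤ K / β) :
    excessLoss f a b ≤ c * (K / √β) := by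
  have hc := nonneg_of_forall_le_mul_sqrt hf1 hfc
  rcases ha.eq_or_lt with rfl | ha
  · rw [excessLoss, zero_mul]
    positivity
  have hb : 0 < b := pos_of_mul_pos_right (ha.trans_le hab) hK.le
  have hfa : 0 ≤ f (1 / a) := by
    have hz : 1 ≤ 1 / a := (one_le_div ha).2 ha1
    exact hf1.trans (hm (mem_Ici.2 le_rfl) hz hz)
  have hsqrt : a * √(1 / b) ≤ K / √β := by
    refine abs_le_of_sq_le_sq' ?_ (by positivity) |>.2
    rw [mul_pow, div_pow, Real.sq_sqrt (by positivity), Real.sq_sqrt hβ.le, mul_one_div,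
      div_le_iff₀ hb]
    calc a ^ 2 ≤ K * b * (K / β) := by rw [sq]; gcongr
      _ = K ^ 2 / β * b := by ring
  calc excessLoss f a b ≤ a * (c * √(1 / b)) :=
        mul_le_mul_of_nonneg_left
          ((sub_le_self _ hfa).trans (hfc _ ((one_le_div hb).2 hb1))) ha.le
    _ = c * (a * √(1 / b)) := mul_left_comm _ _ _
    _ ≤ c * (K / √β) := mul_le_mul_of_nonneg_left hsqrt hc

lemma sum_mul_le_sum_mul_of_add_le {X : Type*} {G : Finset X} {p Y : X → ℝ} {F r : ℝ}
    (hp : ∀ x ∈ G, 0 ≤ p x) (hp1 : ∑ x ∈ G, p x ≤ 1) (hY : ∀ x ∈ G, -F ≤ Y x)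
    (hr : r + (1 - ∑ x ∈ G, p x) * F ≤ ∑ x ∈ G, p x * Y x) :
    (∑ x ∈ G, p x) * r ≤ ∑ x ∈ G, p x * Y x := by
  rcases le_or_gt r (-F) with hrF | hrF
  · rw [Finset.sum_mul]
    exact Finset.sum_le_sum fun x hx => mul_le_mul_of_nonneg_left (hrF.trans (hY x hx)) (hp x hx)
  · nlinarith

variable {X : Type u} [Fintype X] {p q : X → ℝ} {ℓ : (X → ℝ) → X → ℝ}

lemma IsInverseLoss.mul_sub_eq_excessLoss (hℓ : IsInverseLoss ℓ f) (hp : p ∈ stdSimplex ℝ X)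
    (hq : q ∈ stdSimplex ℝ X) {x : X} (hpq : 0 < p x → 0 < q x) :
    p x * (ℓ q x - ℓ p x) = excessLoss f (p x) (q x) := by
  rcases (hp.1 x).eq_or_lt with hx | hx
  · simp [excessLoss, ← hx]
  · rw [excessLoss, hℓ q hq x (hpq hx), hℓ p hp x hx]

lemma IsInverseLoss.abs_sub_le (hℓ : IsInverseLoss ℓ f) (hf1 : 0 ≤ f 1)
    (hm : MonotoneOn f (Ici 1)) (hp : p ∈ stdSimplex ℝ X) (hq : q ∈ stdSimplex ℝ X) (hβ : 0 < β)
    (hK : 1 ≤ K) {x : X} (hpq : p x ≤ K * q x) (hx : K / β ≤ p x) :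
    |ℓ q x - ℓ p x| ≤ f β := by
  have hK0 := zero_lt_one.trans_le hK
  have hp0 : 0 < p x := (div_pos hK0 hβ).trans_le hx
  have hq0 : 0 < q x := pos_of_mul_pos_right (hp0.trans_le hpq) hK0.le
  rw [div_le_iff₀' hβ] at hx
  have hqβ : 1 ≤ β * q x := by
    refine le_of_mul_le_mul_left ?_ hK0
    calc K * 1 ≤ β * p x := by linarith
      _ ≤ β * (K * q x) := mul_le_mul_of_nonneg_left hpq hβ.le
      _ = K * (β * q x) := mul_left_comm _ _ _
  have hfp := apply_one_div_mem_Icc hf1 hm hp0 (mem_Icc_of_mem_stdSimplex hp x).2 (hK.trans hx)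
  have hfq := apply_one_div_mem_Icc hf1 hm hq0 (mem_Icc_of_mem_stdSimplex hq x).2 hqβ
  rw [hℓ q hq x hq0, hℓ p hp x hp0]
  exact (abs_sub_le_of_le_of_le hfq.1 hfq.2 hfp.1 hfp.2).trans_eq (sub_zero _)

lemma IsInverseLoss.sum_mul_le_sum_mul_sub (hℓ : IsInverseLoss ℓ f) (hf1 : 0 ≤ f 1)
    (hm : MonotoneOn f (Ici 1)) (hfc : ∀ z, 1 ≤ z → f z ≤ c * √z) (hp : p ∈ stdSimplex ℝ X)
    (hq : q ∈ stdSimplex ℝ X) (hβ : 1 ≤ β) (hK : 1 ≤ K) (hpq : ∀ x, p x ≤ K * q x) {r : ℝ}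
    (hr : r + 2 * (Fintype.card X * (c * (K / √β))) ≤ ∑ x, excessLoss f (p x) (q x)) :
    (∑ x with K / β ≤ p x, p x) * r ≤ ∑ x with K / β ≤ p x, p x * (ℓ q x - ℓ p x) := by
  have hβ0 := zero_lt_one.trans_le hβ
  have hK0 := zero_lt_one.trans_le hK
  have hc := nonneg_of_forall_le_mul_sqrt hf1 hfc
  have hpq0 (x : X) (hx : 0 < p x) : 0 < q x := pos_of_mul_pos_right (hx.trans_le (hpq x)) hK0.le
  have hsmall {x : X} (hx : x ∈ Finset.univ.filter fun x => ¬ K / β ≤ p x) : p x ≤ K / β :=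
    (not_le.1 (Finset.mem_filter.1 hx).2).le
  have hloss : ∑ x with ¬ K / β ≤ p x, excessLoss f (p x) (q x)
      ≤ Fintype.card X * (c * (K / √β)) :=
    sum_le_card_univ_mul (by positivity) fun x hx =>
      excessLoss_le_mul_div_sqrt hf1 hm hfc hβ0 hK0 (hp.1 x) (mem_Icc_of_mem_stdSimplex hp x).2
        (mem_Icc_of_mem_stdSimplex hq x).2 (hpq x) (hsmall hx)
  have hmass : (∑ x with ¬ K / β ≤ p x, p x) * f β ≤ Fintype.card X * (c * (K / √β)) := by
    calc (∑ x with ¬ K / β ≤ p x, p x) * f β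
        ≤ Fintype.card X * (K / β) * (c * √β) :=
          mul_le_mul (sum_le_card_univ_mul (by positivity) fun x hx => hsmall hx) (hfc β hβ)
            (hf1.trans (hm (mem_Ici.2 le_rfl) hβ hβ)) (by positivity)
      _ = Fintype.card X * (c * (K * (√β / β))) := by ring
      _ = Fintype.card X * (c * (K / √β)) := by rw [Real.sqrt_div_self, div_eq_mul_inv K]
  have hp_split := Finset.sum_filter_add_sum_filter_not Finset.univ (fun x => K / β ≤ p x) p
  have hloss_split := Finset.sum_filter_add_sum_filter_not Finset.univ (fun x => K / β ≤ p x)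
    fun x => excessLoss f (p x) (q x)
  rw [hp.2] at hp_split
  refine sum_mul_le_sum_mul_of_add_le (F := f β) (fun x _ => hp.1 x)
    (hp.2 ▸ Finset.sum_le_univ_sum_of_nonneg hp.1)
    (fun x hx => neg_le_of_abs_le
      (hℓ.abs_sub_le hf1 hm hp hq hβ0 hK (hpq x) (Finset.mem_filter.1 hx).2)) ?_
  simp only [hℓ.mul_sub_eq_excessLoss hp hq (hpq0 _)]
  rw [← eq_sub_iff_add_eq'.2 hp_split]
  linarith

theorem IsInverseLoss.one_sub_le_measureReal_lt_expectedLoss_sub (hℓ : IsInverseLoss ℓ f)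
    (hf1 : 0 ≤ f 1) (hm : MonotoneOn f (Ici 1)) (hfc : ∀ z, 1 ≤ z → f z ≤ c * √z)
    (hp : p ∈ stdSimplex ℝ X) (hq : q ∈ stdSimplex ℝ X) (hβ : 1 ≤ β) (hfβ : 0 < f β) (hK : 1 ≤ K)
    (hpq : ∀ x, p x ≤ K * q x) [MeasurableSpace X] [MeasurableSingletonClass X] {Ω : Type v}
    [MeasurableSpace Ω] {P : Measure Ω} {n : ℕ} {S : Fin n → Ω → X} (hS : IsIIDSample P S p)
    {t γ δ : ℝ} (hγ : 0 < γ) (hδ : 0 < δ)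
    (ht : t + γ + 2 * (Fintype.card X * (c * (K / √β))) ≤ ∑ x, excessLoss f (p x) (q x))
    (hnβ : n * (Fintype.card X * (K / β)) ≤ δ / 4)
    (hn : 4 * f β ^ 2 * Real.log (1 / δ) / γ ^ 2 ≤ n) :
    1 - δ ≤ P.real {ω | t < expectedLoss ℓ q (empirical fun i => S i ω)
      - expectedLoss ℓ p (empirical fun i => S i ω)} := by
  have := hS.2.1.isProbabilityMeasure
  have hβ0 := zero_lt_one.trans_le hβ
  have := zero_lt_one.trans_le hK
  have hp_split := Finset.sum_filter_add_sum_filter_not Finset.univ (fun x => K / β ≤ p x) p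
  rw [hp.2] at hp_split
  have hsum := hS.one_sub_le_measureReal_lt_sum (Y := fun x => ℓ q x - ℓ p x) hfβ
    (fun x hx => hℓ.abs_sub_le hf1 hm hp hq hβ0 hK (hpq x) (Finset.mem_filter.1 hx).2) hγ
    (hℓ.sum_mul_le_sum_mul_sub hf1 hm hfc hp hq hβ hK hpq ht) hδ (by
      rw [← eq_sub_iff_add_eq'.2 hp_split]
      refine le_trans ?_ hnβ
      gcongr
      exact sum_le_card_univ_mul (by positivity) fun x hx =>
        (not_le.1 (Finset.mem_filter.1 hx).2).le) hn
  refine hsum.trans (measureReal_mono fun ω hω => ?_)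
  rw [mem_ofPred_eq] at hω ⊢
  rw [expectedLoss_empirical, expectedLoss_empirical, ← sub_div, ← Finset.sum_sub_distrib]
  rcases n.eq_zero_or_pos with rfl | hn0
  · simp at hω
  · rwa [lt_div_iff₀' (by exact_mod_cast hn0)]

end Truncation

section Threshold

variable {N a β δ : ℝ}

lemma le_mul_of_div_mul_min_le (ha : 0 < a) (hδ : 0 < δ)
    (hβ : 576 * N ^ 8 / (δ * min 1 (a ^ 2)) ≤ β) : 576 * N ^ 8 ≤ β * δ := by
  have : 0 < min 1 (a ^ 2) := lt_min one_pos (sq_pos_of_pos ha)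
  rw [← div_le_iff₀ hδ]
  refine le_trans ?_ hβ
  gcongr
  exact mul_le_of_le_one_right hδ.le (min_le_left _ _)

lemma mul_div_sqrt_le_of_div_mul_min_le (ha : 0 < a) (hN : 1 ≤ N) (hδ : 0 < δ) (hδ1 : δ ≤ 1)
    (hβ : 576 * N ^ 8 / (δ * min 1 (a ^ 2)) ≤ β) {c : ℝ} (hc : 0 ≤ c) :
    N * (c * (2 * N / √β)) ≤ c * a / 12 := by
  have hmin : 0 < min 1 (a ^ 2) := lt_min one_pos (sq_pos_of_pos ha)
  have hsqrt : 24 * N ^ 4 / a ≤ √β := by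
    refine Real.le_sqrt_of_sq_le (le_trans ?_ hβ)
    rw [div_pow, show (24 * N ^ 4) ^ 2 = 576 * N ^ 8 by ring]
    gcongr
    exact (mul_le_of_le_one_left hmin.le hδ1).trans (min_le_right _ _)
  calc N * (c * (2 * N / √β)) ≤ N * (c * (2 * N / (24 * N ^ 4 / a))) := by gcongr
    _ = c * a / 12 / N ^ 2 := by field_simp; ring
    _ ≤ c * a / 12 := div_le_self (by positivity) (one_le_pow₀ hN)

lemma two_le_of_le_mul (hN : 1 ≤ N) (hδ : 0 < δ) (hδ1 : δ ≤ 1) (hβδ : 576 * N ^ 8 ≤ β * δ) :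
    2 ≤ β := by
  have hN8 : 1 ≤ N ^ 8 := one_le_pow₀ hN
  have hβ : 0 < β := pos_of_mul_pos_left (by linarith) hδ.le
  linarith [mul_le_of_le_one_right hβ.le hδ1]

lemma mul_mul_div_le_of_le_mul (hN : 1 ≤ N) (hβ : 0 < β) (hβδ : 576 * N ^ 8 ≤ β * δ) :
    N * (N * (2 * N / β)) ≤ δ / 4 := by
  have hpow : N ^ 3 ≤ N ^ 8 := pow_le_pow_right₀ hN (by norm_num)
  have : 0 < N ^ 3 := by positivity
  calc N * (N * (2 * N / β)) = 2 * N ^ 3 / β := by ring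
    _ ≤ δ / 4 := by
      rw [div_le_div_iff₀ hβ (by norm_num)]
      linarith

end Threshold

end LossDist

open LossDist in
theorem mainTheorem9_general {X : Type u} [Fintype X] [MeasurableSpace X]
    [MeasurableSingletonClass X] {ℓ : (X → ℝ) → X → ℝ} {f C D : ℝ → ℝ} {c : ℝ}
    (hℓ : IsInverseLoss ℓ f) (hf1 : 0 ≤ f 1) (hm : MonotoneOn f (Ici 1))
    (hf : ConcaveOn ℝ (Ici 1) f) (hd : DifferentiableOn ℝ f (Ici 1))
    (hfc : ∀ z, 1 ≤ z → f z ≤ c * √z) (hDm : MonotoneOn D (Ici 1))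
    (hD : ∀ z, 1 ≤ z → derivWithin f (Ici 1) z ≤ D z / z)
    (hs : LeftStronglyConcave f fun x => C x / x ^ 2) (hC : AntitoneOn C (Ici 1))
    {p q : X → ℝ} (hp : p ∈ stdSimplex ℝ X) {α₁ α₂ : ℝ} (hq : q ∈ approxCalibratedSet p α₁ α₂)
    (hpq : 0 < l1Dist p q) (hα₁ : α₁ ≤ 1 / 3) (hα₂ : 0 < α₂) (hα₂' : α₂ ≤ 1 / 3)
    (hC2 : 0 < C (2 * Fintype.card X / α₂)) {δ : ℝ} (hδ : 0 < δ) {β : ℝ}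
    (hβ : 576 * (Fintype.card X : ℝ) ^ 8 / (δ * min 1
      ((C (2 * Fintype.card X / α₂) * (l1Dist p q ^ 2 / (128 * c))) ^ 2)) ≤ β)
    {m : ℕ} (hmN : m ≤ Fintype.card X)
    (hmβ : 4000000 * f β ^ 2 * Real.log (1 / δ)
      / (C (Fintype.card X / (2 * α₂)) * l1Dist p q ^ 2) ^ 2 ≤ m)
    {Ω : Type v} [MeasurableSpace Ω] {P : Measure Ω} {S : Fin m → Ω → X}
    (hS : IsIIDSample P S p) :
    1 - δ ≤ P.real {ω |
      expectedLoss ℓ q (empirical fun i => S i ω) - expectedLoss ℓ p (empirical fun i => S i ω)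
        > C (Fintype.card X / (2 * α₂)) * (l1Dist p q ^ 2 / 384)
          - 2 * α₁ * D (Fintype.card X / (2 * α₂)) - 3 * α₂ * f (Fintype.card X / (3 * α₂))} := by
  rcases le_or_gt 1 δ with hδ1 | hδ1
  · exact (sub_nonpos.2 hδ1).trans measureReal_nonneg
  obtain ⟨T, hT⟩ := hq.2.exists_calibratedOff hq.1
  have hN : (2 : ℝ) ≤ Fintype.card X := by exact_mod_cast two_le_card_of_l1Dist_pos hp hq.1 hpq
  set N : ℝ := (Fintype.card X : ℝ)
  set Δ := l1Dist p q
  set E := N / (2 * α₂)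
  have hE : 2 ≤ E := two_le_card_div hp hq.1 hpq hα₂ (by linarith)
  have hCE : C (2 * N / α₂) ≤ C E := apply_two_mul_div_le hC hα₂ (one_le_two.trans hE)
  have hCE0 := hC2.trans_le hCE
  have hf2 : 0 < f 2 :=
    (div_pos hCE0 (by norm_num)).trans_le (hs.div_eight_le_apply_two hd hm hf1 hC hE)
  have hc : 0 < c := pos_of_mul_pos_left (hf2.trans_le (hfc 2 one_le_two)) (Real.sqrt_nonneg 2)
  have hβδ := le_mul_of_div_mul_min_le (by positivity) hδ hβ
  have hβ2 : 2 ≤ β := two_le_of_le_mul (by linarith) hδ hδ1.le hβδ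
  have hslack : N * (c * (2 * N / √β)) ≤ C E * Δ ^ 2 / 1536 := by
    calc N * (c * (2 * N / √β)) ≤ c * (C (2 * N / α₂) * (Δ ^ 2 / (128 * c))) / 12 :=
          mul_div_sqrt_le_of_div_mul_min_le (by positivity) (by linarith) hδ hδ1.le hβ hc.le
      _ = C (2 * N / α₂) * Δ ^ 2 / 1536 := by field_simp; norm_num
      _ ≤ C E * Δ ^ 2 / 1536 := by gcongr
  refine hℓ.one_sub_le_measureReal_lt_expectedLoss_sub hf1 hm hfc hp hq.1 (by linarith)
    (hf2.trans_le (hm (mem_Ici.2 one_le_two) (mem_Ici.2 (one_le_two.trans hβ2)) hβ2))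
    (K := 2 * N) (by linarith) ?_ hS (γ := C E * Δ ^ 2 / 1000) (by positivity) hδ ?_ ?_ ?_
  · intro x
    have := hT.mul_le_card_mul hp.1 hq.1.1 (by linarith) x
    nlinarith [hp.1 x]
  · have hcore := hT.le_sum_excessLoss hα₁ hα₂ hα₂' hf1 hf hd hm hDm hD hs hC hp hq.1 hCE0.le hpq
    have hα₁D := mul_nonneg (hT.nonneg hp hq.1 (by linarith))
      (nonneg_of_derivWithin_le_div hm hD (one_le_two.trans hE))
    have := mul_pos hCE0 (pow_pos hpq 2)
    linarith
  · calc m * (N * (2 * N / β)) ≤ N * (N * (2 * N / β)) :=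
          mul_le_mul_of_nonneg_right (Nat.cast_le.2 hmN) (by positivity)
      _ ≤ δ / 4 := mul_mul_div_le_of_le_mul (by linarith) (by linarith) hβδ
  · refine le_of_eq_of_le ?_ hmβ
    field_simp
    ring

open LossDist in
theorem mainTheorem9 :
    ∃ c₁ : ℝ, 0 < c₁ ∧
      ∀ (X : Type u) [Fintype X] [MeasurableSpace X] [MeasurableSingletonClass X]
        (ℓ : (X → ℝ) → X → ℝ) (f C D : ℝ → ℝ) (c : ℝ),
        IsInverseLoss ℓ f →
        (∀ z, 1 ≤ z → 0 ≤ f z) →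
        MonotoneOn f (Ici 1) →
        ConcaveOn ℝ (Ici 1) f →
        DifferentiableOn ℝ f (Ici 1) →
        (∀ z, 1 ≤ z → f z ≤ c * √z) →
        MonotoneOn D (Ici 1) →
        (∀ z, 1 ≤ z → derivWithin f (Ici 1) z ≤ D z / z) →
        LeftStronglyConcave f (fun x => C x / x ^ 2) →
        AntitoneOn C (Ici 1) →
        (∀ x, 1 ≤ x → 0 ≤ C x) →
      ∀ p ∈ stdSimplex ℝ X, ∀ (α₁ α₂ : ℝ), ∀ q ∈ approxCalibratedSet p α₁ α₂,
        0 < α₂ →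
        α₁ ≤ l1Dist p q ^ 2 / 12 →
        α₂ ≤ l1Dist p q ^ 2 / 12 →
      ∀ (N : ℝ), N = Fintype.card X →
        0 < C (2 * N / α₂) →
      ∀ (δ : ℝ), 0 < δ → δ ≤ 1 →
      ∀ (β : ℝ),
        β = 576 * N ^ 8 /
          (δ * min 1 ((C (2 * N / α₂) * (l1Dist p q ^ 2 / (128 * c))) ^ 2)) →
      ∀ (m : ℕ), (m : ℝ) ≤ N →
        c₁ * f β ^ 2 * Real.log (1 / δ) / (C (N / (2 * α₂)) * l1Dist p q ^ 2) ^ 2 ≤ m →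
      ∀ (Ω : Type v) [MeasurableSpace Ω] (P : Measure Ω) [IsProbabilityMeasure P]
        (S : Fin m → Ω → X), IsIIDSample P S p →
        1 - δ ≤ P.real {ω |
          expectedLoss ℓ q (empirical fun i => S i ω)
              - expectedLoss ℓ p (empirical fun i => S i ω)
            > C (N / (2 * α₂)) * (l1Dist p q ^ 2 / 384)
              - 2 * α₁ * D (N / (2 * α₂)) - 3 * α₂ * f (N / (3 * α₂))} := by
  refine ⟨4000000, by norm_num, ?_⟩
  rintro X _ _ _ ℓ f C D c hℓ hf0 hm hf hd hfc hDm hD hs hC - p hp α₁ α₂ q hq hα₂ hα₁ hα₂' _ rfl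
    hC2 δ hδ - β rfl m hmN hmβ Ω _ P _ S hS
  have hdist := sq_l1Dist_div_le hp hq.1
  exact mainTheorem9_general hℓ (hf0 1 le_rfl) hm hf hd hfc hDm hD hs hC hp hq
    (l1Dist_pos_of_sq_div_pos (hα₂.trans_le hα₂')) (hα₁.trans hdist) hα₂ (hα₂'.trans hdist) hC2 hδ
    le_rfl (Nat.cast_le.1 hmN) hmβ hS
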